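/- Let $(X,d)$ be a complete separable metric space, $\mathfrak m$ a Borel measure on $X$ that is finite on bounded sets, and $1\le p<\infty$. For $\varepsilon>0$, an $\varepsilon$-chain is a finite sequence $c=(q_0,\dots,q_N)$ of points of $X$ with $d(q_i,q_{i+1})\le\varepsilon$ for all $i$; for $g\colon X\to[0,\infty]$ put $$\int_c g:=\sum_{i=0}^{N-1}\frac{g(q_i)+g(q_{i+1})}{2}\,d(q_i,q_{i+1})\qquad(\infty\cdot 0:=0).$$ A Borel function $g\colon X\to[0,\infty]$ is an $\varepsilon$-upper gradient of $u\colon X\to\mathbb R$, written $g\in \mathrm{UG}^\varepsilon(u)$, if $|u(q_N)-u(q_0)|\le\int_c g$ for every $\varepsilon$-chain $c=(q_0,\dots,q_N)$; let $\mathrm{LUG}^\varepsilon(u)$ be the set of (real-valued) Lipschitz functions in $\mathrm{UG}^\varepsilon(u)$. For $p$-integrable functions $u\colon X\to\mathbb R$ define, with $\inf\emptyset=+\infty$, $$F_{C}(u):=\lim_{\varepsilon\to0^+}\inf\{\|g\|_{L^p(X)}: g\in \mathrm{UG}^\varepsilon(u)\},\qquad F_{C,\mathrm{Lip}}(u):=\begin{cases}\displaystyle\lim_{\varepsilon\to0^+}\inf\{\|g\|_{L^p(X)}: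 g\in \mathrm{LUG}^\varepsilon(u)\}&\text{if } u \text{ is Lipschitz},\\ +\infty&\text{otherwise.}\end{cases}$$ For $F\in\{F_C,F_{C,\mathrm{Lip}}\}$ and $u\in L^p(X)$ define the relaxation, the space and the ($[0,\infty]$-valued) norm $$\widetilde F(u):=\inf\Big\{\liminf_{j\to\infty}F(u_j): u_j\to u\text{ in }L^p(X)\Big\},\qquad H^{1,p}_F(X):=\{u\in L^p(X):\widetilde F(u)<\infty\},\qquad \|u\|_{H^{1,p}_F(X)}:=\big(\|u\|_{L^p(X)}^p+\widetilde F(u)^p\big)^{1/p},$$ and write $H^{1,p}_{C}(X)$, $H^{1,p}_{C,\mathrm{Lip}}(X)$ for the spaces given by $F_C$, $F_{C,\mathrm{Lip}}$. Then $$H^{1,p}_{C,\mathrm{Lip}}(X)=H^{1,p}_{C}(X)\qquad\text{and}\qquad \|u\|_{H^{1,p}_{C,\mathrm{Lip}}(X)}=\|u\|_{H^{1,p}_{C}(X)}\quad\text{for every }u\in L^p(X).$$ In particular, the relaxed chain energy is realized by Lipschitz functions with Lipschitz chain upper gradients: for every $u\in H^{1,p}_{C}(X)$ there are $p$-integrable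 Lipschitz functions $u_j$, numbers $\varepsilon_j>0$ with $\varepsilon_j\to0$, and $g_j\in\mathrm{LUG}^{\varepsilon_j}(u_j)$ such that $u_j\to u$ in $L^p(X)$ and $\|g_j\|_{L^p(X)}\to\widetilde F_{C}(u)$. -/

import Mathlib

open MeasureTheory Filter Topology
open scoped ENNReal NNReal

noncomputable section

namespace ChainSobolev

/-- A chain in `X`: a finite ordered collection of points `q_0, …, q_N`. -/
structure Chain (X : Type*) where
  N : ℕ
  pt : Fin (N + 1) → X

namespace Chain

variable {X : Type*}

/-- The first point `q_0` of a chain. -/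
def first (c : Chain X) : X := c.pt 0

/-- The last point `q_N` of a chain. -/
def last (c : Chain X) : X := c.pt (Fin.last c.N)

variable [MetricSpace X]

/-- `c` is an `ε`-chain: consecutive points are at distance at most `ε`. -/
def IsEps (ε : ℝ) (c : Chain X) : Prop :=
  ∀ i : Fin c.N, dist (c.pt i.castSucc) (c.pt i.succ) ≤ ε

/-- The integral of `g` along a chain, `∑ (g(q_i) + g(q_{i+1})) / 2 * d(q_i, q_{i+1})`
(with `∞ * 0 = 0`, so that a constant step contributes nothing). -/
def integral (c : Chain X) (g : X → ℝ≥0∞) : ℝ≥0∞ :=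
  ∑ i : Fin c.N, (g (c.pt i.castSucc) + g (c.pt i.succ)) / 2 *
    edist (c.pt i.castSucc) (c.pt i.succ)

end Chain

section Energies

variable {X : Type*} [MetricSpace X] [MeasurableSpace X]

/-- The set of `ε`-upper gradients of `u`: Borel functions `g : X → [0,∞]` with
`|u(q_N) - u(q_0)| ≤ ∫_c g` for every `ε`-chain `c = (q_0, …, q_N)`. -/
def UG (ε : ℝ) (u : X → ℝ) : Set (X → ℝ≥0∞) :=
  {g | Measurable g ∧
    ∀ c : Chain X, c.IsEps ε → ENNReal.ofReal |u c.last - u c.first| ≤ c.integral g}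

/-- The set of Lipschitz `ε`-upper gradients of `u` (in particular they are finite-valued). -/
def LUG (ε : ℝ) (u : X → ℝ) : Set (X → ℝ≥0∞) :=
  {g | g ∈ UG ε u ∧ ∃ h : X → ℝ≥0, (∃ K : ℝ≥0, LipschitzWith K h) ∧ g = fun x => (h x : ℝ≥0∞)}

/-- `inf {‖g‖_{L^p} : g an ε-upper gradient of u}`, equal to `∞` if there is none. -/
def chainEnergyAt (p : ℝ≥0∞) (μ : Measure X) (u : X → ℝ) (ε : ℝ) : ℝ≥0∞ :=
  ⨅ g ∈ UG ε u, eLpNorm g p μ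

/-- `inf {‖g‖_{L^p} : g a Lipschitz ε-upper gradient of u}`, equal to `∞` if there is none. -/
def lipChainEnergyAt (p : ℝ≥0∞) (μ : Measure X) (u : X → ℝ) (ε : ℝ) : ℝ≥0∞ :=
  ⨅ g ∈ LUG ε u, eLpNorm g p μ

/-- The chain energy: the limit, as `ε → 0+`, of `chainEnergyAt p μ u ε`. This quantity is
nondecreasing in `ε`, so the limit is the infimum over `ε > 0`; see `tendsto_chainEnergyAt`. -/
def chainEnergy (p : ℝ≥0∞) (μ : Measure X) (u : X → ℝ) : ℝ≥0∞ :=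
  ⨅ ε ∈ Set.Ioi (0 : ℝ), chainEnergyAt p μ u ε

open Classical in
/-- The Lipschitz chain energy: the limit, as `ε → 0+`, of `lipChainEnergyAt p μ u ε` if `u` is
Lipschitz (see `tendsto_lipChainEnergyAt`), and `∞` otherwise. -/
def lipChainEnergy (p : ℝ≥0∞) (μ : Measure X) (u : X → ℝ) : ℝ≥0∞ :=
  if ∃ K : ℝ≥0, LipschitzWith K u then ⨅ ε ∈ Set.Ioi (0 : ℝ), lipChainEnergyAt p μ u ε else ∞

theorem UG_subset {ε ε' : ℝ} (h : ε' ≤ ε) (u : X → ℝ) : UG ε u ⊆ UG ε' u :=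
  fun _ hg => ⟨hg.1, fun c hc => hg.2 c fun i => (hc i).trans h⟩

theorem LUG_subset {ε ε' : ℝ} (h : ε' ≤ ε) (u : X → ℝ) : LUG ε u ⊆ LUG ε' u :=
  fun _ hg => ⟨UG_subset h u hg.1, hg.2⟩

theorem tendsto_chainEnergyAt (p : ℝ≥0∞) (μ : Measure X) (u : X → ℝ) :
    Tendsto (chainEnergyAt p μ u) (𝓝[>] 0) (𝓝 (chainEnergy p μ u)) := by
  have hm : Monotone (chainEnergyAt p μ u) := fun _ _ h => biInf_mono (UG_subset h u)
  simpa only [chainEnergy, sInf_image] using hm.tendsto_nhdsGT 0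

theorem tendsto_lipChainEnergyAt (p : ℝ≥0∞) (μ : Measure X) (u : X → ℝ)
    (hu : ∃ K : ℝ≥0, LipschitzWith K u) :
    Tendsto (lipChainEnergyAt p μ u) (𝓝[>] 0) (𝓝 (lipChainEnergy p μ u)) := by
  have hm : Monotone (lipChainEnergyAt p μ u) := fun _ _ h => biInf_mono (LUG_subset h u)
  simpa only [lipChainEnergy, if_pos hu, sInf_image] using hm.tendsto_nhdsGT 0

end Energies

section Relaxation

variable {X : Type*} [MeasurableSpace X]

/-- The `L^p`-relaxation of a functional `F` on `p`-integrable functions: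
`inf {liminf_j F(v_j) : v_j → u in L^p}`. -/
def relaxation (p : ℝ≥0∞) (μ : Measure X) (F : (X → ℝ) → ℝ≥0∞) (u : Lp ℝ p μ) : ℝ≥0∞ :=
  ⨅ v ∈ {v : ℕ → X → ℝ | (∀ j, MemLp (v j) p μ) ∧
      Tendsto (fun j => eLpNorm (v j - ⇑u) p μ) atTop (𝓝 0)},
    liminf (fun j => F (v j)) atTop

/-- The space of those `u ∈ L^p` whose relaxed energy is finite. -/
def sobolevSpace (p : ℝ≥0∞) (μ : Measure X) (F : (X → ℝ) → ℝ≥0∞) : Set (Lp ℝ p μ) :=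
  {u | relaxation p μ F u < ∞}

/-- The norm `(‖u‖_{L^p}^p + (relaxed energy of u)^p)^{1/p}`, as a function on all of `L^p` with
values in `[0,∞]`; it is finite exactly on `sobolevSpace p μ F`. -/
def sobolevNorm (p : ℝ≥0∞) (μ : Measure X) (F : (X → ℝ) → ℝ≥0∞) (u : Lp ℝ p μ) : ℝ≥0∞ :=
  (eLpNorm u p μ ^ p.toReal + relaxation p μ F u ^ p.toReal) ^ (1 / p.toReal)

end Relaxation

end ChainSobolev

end

noncomputable section

namespace ChainSobolev

/-! ### One-step form of the chain condition, and Lipschitz bounds from a fixed scale -/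

section Pairs

variable {X : Type*} [MetricSpace X]

/-! Lipschitz gradients are gradients, so one inequality is immediate. For the other it is enough to
approximate a single pair, `u` in `L^p` and `g` an `ε`-upper gradient of finite norm, by a Lipschitz
pair at some scale `ρ > 0`, with arbitrarily small error in `‖u‖` and arbitrarily small excess in
`‖g‖` (`exists_lipschitz_approx`); a diagonal argument then finishes. By telescoping, the chain
condition is a condition on pairs of points at distance at most `ε`.

Truncation in value, Lipschitz extension from a sublevel set of `g`, and a slow cutoff reduce to a
bounded Lipschitz `v` of bounded support with a bounded Borel gradient `G`. What remains is to make
`G` Lipschitz. Lusin's theorem gives this on a large compact set `K`, but an exact gradient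
inequality for arbitrarily close pairs does not survive moving the points to `K`.

The remedy is to ask for control at one scale `τ` only: `|v x - v y| ≤ τ * (h x + h y) / 2` whenever
`dist x y ≤ τ + ρ`. Moving the points by `ρ`, much smaller than `τ`, costs only a small multiple of
`τ`, so a Lipschitz `h` with norm close to that of `G` achieves this
(`exists_lipschitz_scale_gradient`). Averaging the estimate over shifts by `τ` along a `ρ`-chain
shows that `h` is an upper gradient of `v` along `ρ`-chains up to an additive error `τ * sup h`
(`ChainCost.sub_le`). Hence the infimum of `v(q_0) + ∫_c h` over `ρ`-chains ending at a point lies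
within `τ * sup h` of `v`, and `h` is an exact gradient of it at scale `ρ`
(`exists_lipschitz_pair_of_scale`). The bound on `h` does not depend on `τ`, so the error vanishes
with `τ`. -/

theorem ofReal_abs_sub_le_sum (ε : ℝ) (u : X → ℝ) (g : X → ℝ≥0∞)
    (hg : ∀ x y, dist x y ≤ ε → ENNReal.ofReal |u x - u y| ≤ (g x + g y) / 2 * edist x y) :
    ∀ (N : ℕ) (q : Fin (N + 1) → X),
      (∀ i : Fin N, dist (q i.castSucc) (q i.succ) ≤ ε) →
      ENNReal.ofReal |u (q (Fin.last N)) - u (q 0)| ≤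
        ∑ i : Fin N, (g (q i.castSucc) + g (q i.succ)) / 2 *
          edist (q i.castSucc) (q i.succ) := by
  intro N
  induction N with
  | zero => intro q _; simp
  | succ N ih =>
    intro q hq
    rw [Fin.sum_univ_castSucc]
    have h1 := ih (fun i => q i.castSucc) (fun i => hq i.castSucc)
    have h2 := hg _ _ (hq (Fin.last N))
    refine le_trans ?_ (add_le_add h1 h2)
    rw [← ENNReal.ofReal_add (abs_nonneg _) (abs_nonneg _)]
    refine ENNReal.ofReal_le_ofReal ?_
    simp only [Fin.succ_last, Fin.castSucc_zero]
    have := abs_sub_le (u (q (Fin.last (N + 1)))) (u (q (Fin.last N).castSucc)) (u (q 0))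
    rw [abs_sub_comm (u (q (Fin.last N).castSucc)) (u (q (Fin.last (N + 1))))]
    linarith

/-- The chain condition defining `UG` reduces to chains with a single step. -/
theorem mem_UG_iff [MeasurableSpace X] {ε : ℝ} {u : X → ℝ} {g : X → ℝ≥0∞} :
    g ∈ UG ε u ↔ Measurable g ∧
      ∀ x y, dist x y ≤ ε → ENNReal.ofReal |u x - u y| ≤ (g x + g y) / 2 * edist x y := by
  refine and_congr_right fun _ => ⟨fun h x y hxy => ?_, fun h c hc => ?_⟩
  · have := h ⟨1, ![x, y]⟩ (by intro i; fin_cases i; simpa using hxy)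
    simpa [Chain.integral, Chain.first, Chain.last, abs_sub_comm (u y)] using this
  · exact ofReal_abs_sub_le_sum ε u g h c.N c.pt hc

/-- A bounded function that is Lipschitz at a fixed scale is Lipschitz. -/
theorem lipschitzOnWith_of_local {f : X → ℝ} {s : Set X} {B S ρ : ℝ} (hρ : 0 < ρ)
    (hB : ∀ x ∈ s, |f x| ≤ B)
    (hS : ∀ x ∈ s, ∀ y ∈ s, dist x y ≤ ρ → |f x - f y| ≤ S * dist x y) :
    LipschitzOnWith (max S (2 * B / ρ)).toNNReal f s := by
  refine LipschitzOnWith.of_dist_le_mul fun x hx y hy => ?_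
  rw [Real.dist_eq]
  have hB0 : 0 ≤ B := (abs_nonneg _).trans (hB x hx)
  rw [Real.coe_toNNReal _ (le_max_of_le_right (by positivity))]
  rcases le_or_gt (dist x y) ρ with h | h
  · exact (hS x hx y hy h).trans (by gcongr; exact le_max_left _ _)
  · calc |f x - f y| ≤ |f x| + |f y| := abs_sub _ _
      _ ≤ 2 * B / ρ * ρ := by
        rw [div_mul_cancel₀ _ hρ.ne']; linarith [hB x hx, hB y hy]
      _ ≤ max S (2 * B / ρ) * dist x y := by
        gcongr
        exact le_max_right _ _

theorem lipschitzWith_of_local {f : X → ℝ} {B S ρ : ℝ} (hρ : 0 < ρ) (hB : ∀ x, |f x| ≤ B)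
    (hS : ∀ x y, dist x y ≤ ρ → |f x - f y| ≤ S * dist x y) :
    LipschitzWith (max S (2 * B / ρ)).toNNReal f :=
  lipschitzOnWith_univ.1 <|
    lipschitzOnWith_of_local hρ (fun x _ => hB x) fun x _ y _ h => hS x y h

end Pairs

/-! ### From control at one scale to an exact gradient: the chain envelope -/

section Envelope

variable {X : Type*} [MetricSpace X]

/-- `ChainCost v h ρ x a` says that `a` is the value `v(q_0) + ∫_c h` for some `ρ`-chain `c` that
starts at `q_0` and ends at `x`. -/
inductive ChainCost (v h : X → ℝ) (ρ : ℝ) : X → ℝ → Prop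
  | base (x : X) : ChainCost v h ρ x (v x)
  | step {x : X} {a : ℝ} (y : X) : ChainCost v h ρ x a → dist x y ≤ ρ →
      ChainCost v h ρ y (a + (h x + h y) / 2 * dist x y)

/-- A chain as a step path, parametrized by arc length and jumping at the midpoints, so that the
integral of `h` along the path is the trapezoidal sum. -/
theorem ChainCost.exists_path {v h : X → ℝ} {ρ : ℝ} (hρ : 0 ≤ ρ) {x : X} {a : ℝ}
    (H : ChainCost v h ρ x a) :
    ∃ (y : X) (l : ℝ) (γ : ℝ → X), 0 ≤ l ∧ (∀ s, l ≤ s → γ s = x) ∧ (∀ s < 0, γ s = y) ∧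
      (∀ s ≤ l, dist (γ s) x ≤ l - s + ρ / 2) ∧
      (∀ s t, s ≤ t → dist (γ s) (γ t) ≤ t - s + ρ) ∧
      (∀ (φ : X → ℝ) (b c : ℝ), IntervalIntegrable (fun s => φ (γ s)) volume b c) ∧
      a = v y + ∫ s in (0 : ℝ)..l, h (γ s) := by
  induction H with
  | base x =>
    refine ⟨x, 0, fun _ => x, le_rfl, fun _ _ => rfl, fun _ _ => rfl, fun s hs => ?_,
      fun s t hst => ?_, fun φ b c => intervalIntegrable_const, by simp⟩
    · rw [dist_self]; linarith
    · rw [dist_self]; linarith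
  | @step x a y _ hxy ih =>
    obtain ⟨z, l, γ, hl, hend, hstart, hx, hγ, hint, ha⟩ := ih
    rcases (dist_nonneg (x := x) (y := y)).eq_or_lt with h0 | hd
    · obtain rfl := dist_eq_zero.1 h0.symm
      exact ⟨z, l, γ, hl, hend, hstart, hx, hγ, hint, by simp [ha]⟩
    set d := dist x y with hdd
    -- The new step takes time `d`, half spent at `x` and half at `y`, which gives its trapezoidal
    -- term. Jumping halfway displaces the path by at most `d / 2 ≤ ρ / 2` from unit speed.
    set γ' : ℝ → X := fun s => if s < l + d / 2 then γ s else y with hγ'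
    have lo : ∀ s, s < l + d / 2 → γ' s = γ s := fun s hs => if_pos hs
    have hi : ∀ s, l + d / 2 ≤ s → γ' s = y := fun s hs => if_neg hs.not_gt
    have hloy : ∀ s, s < l + d / 2 → dist (γ s) y ≤ l + d - s + ρ / 2 := by
      intro s hs
      rcases le_total s l with h | h
      · linarith [dist_triangle (γ s) x y, hx s h]
      · rw [hend s h]; linarith
    have hint' : ∀ (φ : X → ℝ) (b c : ℝ), IntervalIntegrable (fun s => φ (γ' s)) volume b c := by
      intro φ b c
      have e : (fun s => φ (γ' s)) = (Set.Iio (l + d / 2)).indicator (fun s => φ (γ s)) +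
          (Set.Ici (l + d / 2)).indicator (fun _ => φ y) := by
        ext s
        rcases lt_or_ge s (l + d / 2) with h | h
        · simp [lo s h, h]
        · simp [hi s h, h]
      rw [e]
      have h1 := hint φ b c
      have h2 : IntervalIntegrable (fun _ : ℝ => φ y) volume b c := intervalIntegrable_const
      exact IntervalIntegrable.add
        ⟨h1.1.indicator measurableSet_Iio, h1.2.indicator measurableSet_Iio⟩
        ⟨h2.1.indicator measurableSet_Ici, h2.2.indicator measurableSet_Ici⟩
    refine ⟨z, l + d, γ', by linarith, fun s hs => hi s (by linarith), fun s hs => ?_,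
      fun s hs => ?_, fun s t hst => ?_, hint', ?_⟩
    · rw [lo s (by linarith), hstart s hs]
    · rcases lt_or_ge s (l + d / 2) with h | h
      · rw [lo s h]; exact hloy s h
      · rw [hi s h, dist_self]; linarith
    · rcases lt_or_ge t (l + d / 2) with ht | ht
      · rw [lo t ht, lo s (hst.trans_lt ht)]; exact hγ s t hst
      · rw [hi t ht]
        rcases lt_or_ge s (l + d / 2) with h | h
        · rw [lo s h]; linarith [hloy s h]
        · rw [hi s h, dist_self]; linarith
    · have e1 : (∫ s in (0 : ℝ)..l, h (γ' s)) = ∫ s in (0 : ℝ)..l, h (γ s) :=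
        intervalIntegral.integral_congr_Ioo_of_le hl fun s hs => by
          simp only [lo s (by linarith [hs.2])]
      have e2 : (∫ s in l..(l + d / 2), h (γ' s)) = ∫ _ in l..(l + d / 2), h x :=
        intervalIntegral.integral_congr_Ioo_of_le (by linarith) fun s hs => by
          simp only [lo s hs.2, hend s hs.1.le]
      have e3 : (∫ s in (l + d / 2)..(l + d), h (γ' s)) = ∫ _ in (l + d / 2)..(l + d), h y :=
        intervalIntegral.integral_congr_Ioo_of_le (by linarith) fun s hs => by
          simp only [hi s hs.1.le]
      rw [← intervalIntegral.integral_add_adjacent_intervals (hint' h 0 l) (hint' h l (l + d)),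
        ← intervalIntegral.integral_add_adjacent_intervals (hint' h l (l + d / 2))
          (hint' h (l + d / 2) (l + d)), e1, e2, e3, ha]
      simp only [intervalIntegral.integral_const, smul_eq_mul]
      ring

/-- If the oscillation of `v` over distance about `τ` is controlled by `τ` times the mean of `h`,
then `v` almost satisfies the upper gradient inequality along fine chains: average over shifts. -/
theorem ChainCost.sub_le {v h : X → ℝ} {ρ τ S : ℝ} (hρ : 0 ≤ ρ) (hτ : 0 < τ)
    (hS : ∀ x, h x ≤ S)
    (hQ : ∀ x y, dist x y ≤ τ + ρ → |v x - v y| ≤ τ * ((h x + h y) / 2)) {x : X} {a : ℝ}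
    (H : ChainCost v h ρ x a) : v x - τ * S ≤ a := by
  obtain ⟨y, l, γ, hl, hend, hstart, -, hγ, hint, rfl⟩ := H.exists_path hρ
  have shift : ∀ (φ : X → ℝ) (b c : ℝ),
      IntervalIntegrable (fun s => φ (γ (s + τ))) volume b c := by
    intro φ b c
    have := (hint φ (b + τ) (c + τ)).comp_add_right τ
    simpa using this
  -- The path is constant beyond its ends, so a shift by `τ` only adds an end value times `τ`. The
  -- difference of `key` and `key'` for `v` telescopes to `τ * (v x - v y)`.
  have key : ∀ φ : X → ℝ,
      (∫ s in (-τ)..l, φ (γ (s + τ))) = (∫ s in (0 : ℝ)..l, φ (γ s)) + τ * φ x := by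
    intro φ
    rw [intervalIntegral.integral_comp_add_right (fun s => φ (γ s)), neg_add_cancel,
      ← intervalIntegral.integral_add_adjacent_intervals (hint φ 0 l) (hint φ l (l + τ)),
      intervalIntegral.integral_congr_Ioo_of_le (a := l) (g := fun _ => φ x) (by linarith)
        (fun s hs => by simp only [hend s hs.1.le])]
    simp
  have key' : ∀ φ : X → ℝ,
      (∫ s in (-τ)..l, φ (γ s)) = (∫ s in (0 : ℝ)..l, φ (γ s)) + τ * φ y := by
    intro φ
    rw [← intervalIntegral.integral_add_adjacent_intervals (hint φ (-τ) 0) (hint φ 0 l),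
      intervalIntegral.integral_congr_Ioo_of_le (b := 0) (g := fun _ => φ y) (by linarith)
        (fun s hs => by simp only [hstart s hs.2])]
    simp [add_comm]
  have mono : (∫ s in (-τ)..l, (v (γ (s + τ)) - v (γ s))) ≤
      ∫ s in (-τ)..l, τ / 2 * (h (γ (s + τ)) + h (γ s)) := by
    refine intervalIntegral.integral_mono_on (by linarith) ((shift v _ _).sub (hint v _ _))
      (((shift h _ _).add (hint h _ _)).const_mul _) fun s _ => ?_
    have := hQ (γ (s + τ)) (γ s) (by
      rw [dist_comm]; linarith [hγ s (s + τ) (by linarith)])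
    linarith [le_abs_self (v (γ (s + τ)) - v (γ s))]
  rw [intervalIntegral.integral_sub (shift v _ _) (hint v _ _), key, key',
    intervalIntegral.integral_const_mul,
    intervalIntegral.integral_add (shift h _ _) (hint h _ _), key, key'] at mono
  -- The end terms `τ ^ 2 / 2 * (h x + h y)` are the only loss.
  have h1 : τ * (v x - v y) ≤ τ * ((∫ s in (0 : ℝ)..l, h (γ s)) + τ * S) := by
    nlinarith [hS x, hS y, mul_pos hτ hτ]
  have := le_of_mul_le_mul_left h1 hτ
  linarith

/-- Replacing `v` by an infimum over fine chains makes `h` an exact upper gradient at a small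
scale. -/
theorem exists_lipschitz_pair_of_scale {v h : X → ℝ} {ρ τ S B : ℝ} (hρ : 0 < ρ) (hτ : 0 < τ)
    (h0 : ∀ x, 0 ≤ h x) (hS : ∀ x, h x ≤ S) (hB : ∀ x, |v x| ≤ B)
    (hQ : ∀ x y, dist x y ≤ τ + ρ → |v x - v y| ≤ τ * ((h x + h y) / 2)) :
    ∃ w : X → ℝ, (∃ K, LipschitzWith K w) ∧
      (∀ x y, dist x y ≤ ρ → |w x - w y| ≤ (h x + h y) / 2 * dist x y) ∧
      (∀ x, |w x - v x| ≤ τ * S) ∧ ∀ x, v x = 0 → w x = 0 := by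
  set w₀ : X → ℝ := fun x => sInf {a | ChainCost v h ρ x a} with hw₀
  have bdd : ∀ x, BddBelow {a | ChainCost v h ρ x a} := fun x =>
    ⟨v x - τ * S, fun a ha => ha.sub_le hρ.le hτ hS hQ⟩
  have ne : ∀ x, {a | ChainCost v h ρ x a}.Nonempty := fun x => ⟨v x, .base x⟩
  have up : ∀ x, w₀ x ≤ v x := fun x => csInf_le (bdd x) (.base x)
  have low : ∀ x, v x - τ * S ≤ w₀ x := fun x =>
    le_csInf (ne x) fun a ha => ha.sub_le hρ.le hτ hS hQ
  have one : ∀ x y, dist x y ≤ ρ → w₀ y ≤ w₀ x + (h x + h y) / 2 * dist x y := by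
    intro x y hxy
    rw [← sub_le_iff_le_add]
    refine le_csInf (ne x) fun a ha => ?_
    rw [sub_le_iff_le_add]
    exact csInf_le (bdd y) (ChainCost.step y ha hxy)
  have pair₀ : ∀ x y, dist x y ≤ ρ → |w₀ x - w₀ y| ≤ (h x + h y) / 2 * dist x y := by
    intro x y hxy
    have h1 := one x y hxy
    have h2 := one y x (by rwa [dist_comm])
    rw [dist_comm, add_comm (h y)] at h2
    rw [abs_sub_le_iff]
    constructor <;> linarith
  -- A 1-Lipschitz map that collapses `[-τ * S, 0]` to `0` and raises values by at most `τ * S`.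
  -- Where `v = 0` the envelope lies in that interval, so zeros, and with them bounded support, are
  -- preserved.
  set T : ℝ → ℝ := fun t => max t (min (t + τ * S) 0) with hT
  have T1 : ∀ s t, |T s - T t| ≤ |s - t| := by
    intro s t
    refine (abs_max_sub_max_le_max _ _ _ _).trans (max_le le_rfl ?_)
    refine (abs_min_sub_min_le_max _ _ _ _).trans (max_le ?_ ?_)
    · simp
    · simp
  have pair : ∀ x y, dist x y ≤ ρ → |T (w₀ x) - T (w₀ y)| ≤ (h x + h y) / 2 * dist x y :=
    fun x y hxy => (T1 _ _).trans (pair₀ x y hxy)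
  have near : ∀ x, |T (w₀ x) - v x| ≤ τ * S := by
    intro x
    have hS0 : 0 ≤ τ * S := mul_nonneg hτ.le ((h0 x).trans (hS x))
    rw [abs_le]
    constructor
    · linarith [low x, le_max_left (w₀ x) (min (w₀ x + τ * S) 0)]
    · have : T (w₀ x) ≤ w₀ x + τ * S := max_le (by linarith) (min_le_left _ _)
      linarith [up x]
  refine ⟨fun x => T (w₀ x), ⟨_, lipschitzWith_of_local (S := S) (B := B + τ * S) hρ ?_ ?_⟩,
    pair, near, fun x hx => ?_⟩
  · intro x
    have := abs_add_le (T (w₀ x) - v x) (v x)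
    rw [sub_add_cancel] at this
    linarith [near x, hB x]
  · intro x y hxy
    refine (pair x y hxy).trans ?_
    gcongr
    linarith [hS x, hS y]
  · have h1 := low x
    have h2 := up x
    rw [hx] at h1 h2
    simp only [hT]
    rw [min_eq_right (by linarith), max_eq_right h2]

end Envelope

/-! ### Dominated convergence in `L^p` and truncation of values -/

section Truncation

variable {X : Type*} [MeasurableSpace X] {μ : Measure X} {p : ℝ≥0∞}

/-- Dominated convergence to zero in `L^p`. -/
theorem tendsto_eLpNorm_zero_of_dominated (hp₀ : p ≠ 0) (hp : p ≠ ∞) {f : X → ℝ} (hf : MemLp f p μ)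
    {F : ℕ → X → ℝ} (hF : ∀ n, AEStronglyMeasurable (F n) μ) (hle : ∀ n x, |F n x| ≤ |f x|)
    (hlim : ∀ x, Tendsto (fun n => F n x) atTop (𝓝 0)) :
    Tendsto (fun n => eLpNorm (F n) p μ) atTop (𝓝 0) := by
  have hpos : 0 < p.toReal := ENNReal.toReal_pos hp₀ hp
  have h1 : Tendsto (fun n => ∫⁻ x, ‖F n x‖ₑ ^ p.toReal ∂μ) atTop (𝓝 (∫⁻ _, 0 ∂μ)) := by
    refine tendsto_lintegral_of_dominated_convergence' (fun x => ‖f x‖ₑ ^ p.toReal)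
      (fun n => (hF n).enorm.pow_const _) (fun n => ae_of_all _ fun x => ?_)
      (lintegral_rpow_enorm_lt_top_of_eLpNorm_lt_top hp₀ hp hf.2).ne (ae_of_all _ fun x => ?_)
    · refine ENNReal.rpow_le_rpow ?_ hpos.le
      rw [enorm_le_iff_norm_le]
      exact hle n x
    · have := (ENNReal.continuous_rpow_const (y := p.toReal)).tendsto 0 |>.comp
        (by simpa using (hlim x).enorm : Tendsto (fun n => ‖F n x‖ₑ) atTop (𝓝 0))
      simpa [Function.comp_def, hpos] using this
  have h2 := (ENNReal.continuous_rpow_const (y := 1 / p.toReal)).tendsto 0 |>.comp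
    (by simpa using h1)
  have h3 : (0 : ℝ≥0∞) ^ (1 / p.toReal) = 0 := ENNReal.zero_rpow_of_pos (by positivity)
  rw [h3] at h2
  refine h2.congr fun n => ?_
  rw [eLpNorm_eq_lintegral_rpow_enorm_toReal hp₀ hp]
  rfl

/-- Truncation of a real number to `[-k, k]`. -/
def clamp (k t : ℝ) : ℝ := max (-k) (min k t)

theorem abs_clamp_sub_clamp_le (k s t : ℝ) : |clamp k s - clamp k t| ≤ |s - t| := by
  refine (abs_max_sub_max_le_max _ _ _ _).trans (max_le (by simp) ?_)
  refine (abs_min_sub_min_le_max _ _ _ _).trans (max_le (by simp) le_rfl)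

theorem abs_clamp_le {k : ℝ} (hk : 0 ≤ k) (t : ℝ) : |clamp k t| ≤ k :=
  abs_le.2 ⟨le_max_left _ _, max_le (by linarith) (min_le_left _ _)⟩

theorem clamp_eq_self {k t : ℝ} (h : |t| ≤ k) : clamp k t = t := by
  rw [abs_le] at h
  rw [clamp, min_eq_right h.2, max_eq_right h.1]

theorem continuous_clamp (k : ℝ) : Continuous (clamp k) :=
  continuous_const.max (continuous_const.min continuous_id)

theorem abs_clamp_sub_self_le {k : ℝ} (hk : 0 ≤ k) (t : ℝ) : |clamp k t - t| ≤ |t| := by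
  rcases le_or_gt |t| k with h | h
  · rw [clamp_eq_self h]; simp
  · rcases le_total 0 t with h0 | h0
    · rw [abs_of_nonneg h0] at h ⊢
      rw [clamp, min_eq_left h.le, max_eq_right (by linarith), abs_sub_comm, abs_of_nonneg]
      all_goals linarith
    · rw [abs_of_nonpos h0] at h ⊢
      rw [clamp, min_eq_right (by linarith), max_eq_left (by linarith), abs_of_nonneg]
      all_goals linarith

theorem exists_clamp_close (hp₀ : p ≠ 0) (hp : p ≠ ∞) {u : X → ℝ} (hu : MemLp u p μ) {δ : ℝ≥0∞}
    (hδ : 0 < δ) : ∃ k : ℝ, 0 < k ∧ eLpNorm (fun x => clamp k (u x) - u x) p μ ≤ δ := by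
  have := tendsto_eLpNorm_zero_of_dominated hp₀ hp hu
    (F := fun n x => clamp (n + 1) (u x) - u x)
    (fun n => ((continuous_clamp _).comp_aestronglyMeasurable hu.1).sub hu.1)
    (fun n x => abs_clamp_sub_self_le (by positivity) _) (fun x => by
      refine tendsto_const_nhds.congr' ?_
      obtain ⟨N, hN⟩ := exists_nat_ge |u x|
      filter_upwards [eventually_ge_atTop N] with n hn
      have : (N : ℝ) ≤ n := by exact_mod_cast hn
      rw [clamp_eq_self (by linarith), sub_self])
  obtain ⟨n, hn⟩ := (this.eventually (eventually_le_nhds hδ)).exists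
  exact ⟨n + 1, by positivity, hn⟩

theorem ae_lt_top_of_eLpNorm (hp₀ : p ≠ 0) (hp : p ≠ ∞) {g : X → ℝ≥0∞} (hg : Measurable g)
    (hgp : eLpNorm g p μ ≠ ∞) : ∀ᵐ x ∂μ, g x < ∞ := by
  have hpos : 0 < p.toReal := ENNReal.toReal_pos hp₀ hp
  have := lintegral_rpow_enorm_lt_top_of_eLpNorm_lt_top hp₀ hp hgp.lt_top
  filter_upwards [ae_lt_top' ((hg.enorm.pow_const _).aemeasurable) this.ne] with x hx
  rw [enorm_eq_self] at hx
  rwa [ENNReal.rpow_lt_top_iff_of_pos hpos] at hx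

end Truncation

/-! ### Lipschitz truncation of a function with a gradient -/

section LipschitzTruncation

variable {X : Type*} [MetricSpace X] [MeasurableSpace X] {μ : Measure X} {p : ℝ≥0∞}

/-- Lipschitz truncation of a bounded function with an `ε`-upper gradient in `L^p`. -/
theorem exists_lipschitz_truncation (hp₁ : 1 ≤ p) (hp : p ≠ ∞) {u : X → ℝ} {g : X → ℝ≥0∞}
    {ε k δ : ℝ} (hε : 0 < ε) (hk : 0 < k) (hδ : 0 < δ) (hu : ∀ x, |u x| ≤ k) (hg : Measurable g)
    (hgp : eLpNorm g p μ ≠ ∞)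
    (hpair : ∀ x y, dist x y ≤ ε → ENNReal.ofReal |u x - u y| ≤ (g x + g y) / 2 * edist x y) :
    ∃ (v G : X → ℝ) (L : ℝ≥0) (S : ℝ), LipschitzWith L v ∧ (∀ x, |v x| ≤ k) ∧ Measurable G ∧
      (∀ x, 0 ≤ G x) ∧ (∀ x, G x ≤ S) ∧
      (∀ x y, dist x y ≤ ε → |v x - v y| ≤ (G x + G y) / 2 * dist x y) ∧
      eLpNorm (fun x => v x - u x) p μ ≤ ENNReal.ofReal δ ∧
      eLpNorm G p μ ≤ eLpNorm g p μ + ENNReal.ofReal δ := by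
  have hp₀ : p ≠ 0 := (zero_lt_one.trans_le hp₁).ne'
  set f : X → ℝ := fun x => (g x).toReal with hf
  have hfm : Measurable f := hg.ennreal_toReal
  have hfg : eLpNorm f p μ ≤ eLpNorm g p μ := by
    refine eLpNorm_mono_enorm fun x => ?_
    rw [enorm_eq_self, hf, Real.enorm_eq_ofReal ENNReal.toReal_nonneg]
    exact ENNReal.ofReal_toReal_le
  have hfL : MemLp f p μ := ⟨hfm.aestronglyMeasurable, hfg.trans_lt hgp.lt_top⟩
  obtain ⟨M, hM0, hM⟩ := hfL.eLpNorm_indicator_norm_ge_pos_le hfm.stronglyMeasurable hδ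
  set A : ℝ := (eLpNorm g p μ).toReal with hA
  have hA0 : 0 ≤ A := ENNReal.toReal_nonneg
  -- `M` makes the tail of `f` above it small in `L^p`, `2 * k / ε` turns the Lipschitz bound at
  -- scale `ε` on `E` into a global one, and `2 * k * A / δ` gives a Chebyshev-type bound for the
  -- error off `E`.
  set lam : ℝ := max M (max (2 * k / ε) (2 * k * A / δ)) with hlam
  have hlam0 : 0 < lam := lt_max_of_lt_left hM0
  have hlam1 : 2 * k / ε ≤ lam := (le_max_left _ _).trans (le_max_right _ _)
  have hlam2 : 2 * k * A / δ ≤ lam := (le_max_right _ _).trans (le_max_right _ _)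
  set E : Set X := {x | g x ≤ ENNReal.ofReal lam} with hE
  have hfE : ∀ x ∈ E, f x ≤ lam := fun x hx => ENNReal.toReal_le_of_le_ofReal hlam0.le hx
  have hpairE : ∀ x ∈ E, ∀ y ∈ E, dist x y ≤ ε → |u x - u y| ≤ (f x + f y) / 2 * dist x y := by
    intro x hx y hy hxy
    have hgx : g x ≠ ∞ := ((show g x ≤ _ from hx).trans_lt ENNReal.ofReal_lt_top).ne
    have hgy : g y ≠ ∞ := ((show g y ≤ _ from hy).trans_lt ENNReal.ofReal_lt_top).ne
    have := ENNReal.toReal_mono (by finiteness) (hpair x y hxy)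
    rw [ENNReal.toReal_ofReal (abs_nonneg _), ENNReal.toReal_mul, ENNReal.toReal_div,
      ENNReal.toReal_add hgx hgy, edist_dist, ENNReal.toReal_ofReal dist_nonneg] at this
    simpa using this
  have hL : LipschitzOnWith lam.toNNReal u E := by
    have := lipschitzOnWith_of_local (f := u) (s := E) (B := k) (S := lam) hε (fun x _ => hu x)
      fun x hx y hy hxy => (hpairE x hx y hy hxy).trans (by
        gcongr
        linarith [hfE x hx, hfE y hy])
    rwa [max_eq_left hlam1] at this
  obtain ⟨v₀, hv₀, hv₀E⟩ := hL.extend_real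
  have hvL : LipschitzWith lam.toNNReal fun x => clamp k (v₀ x) := (hv₀.const_min k).const_max (-k)
  have hvE : ∀ x ∈ E, clamp k (v₀ x) = u x := fun x hx => by
    rw [← hv₀E hx, clamp_eq_self (hu x)]
  classical
  have hEm : MeasurableSet E := measurableSet_le hg measurable_const
  -- With one point off `E`, the mean of the two values is already at least `lam`, the Lipschitz
  -- constant of the extension. Off `E`, `2 * lam < 2 * f` a.e., so the excess over `f` is bounded
  -- by the tail of `f`.
  set G : X → ℝ := fun x => if x ∈ E then f x else 2 * lam with hG
  have hG0 : ∀ x, 0 ≤ G x := by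
    intro x
    simp only [hG]
    split_ifs
    · exact ENNReal.toReal_nonneg
    · positivity
  have hflt : ∀ᵐ x ∂μ, x ∉ E → lam < f x := by
    filter_upwards [ae_lt_top_of_eLpNorm hp₀ hp hg hgp] with x hx hxE
    exact (ENNReal.ofReal_lt_iff_lt_toReal hlam0.le hx.ne).1 (not_le.1 hxE)
  refine ⟨fun x => clamp k (v₀ x), G, lam.toNNReal, 2 * lam, hvL, fun x => abs_clamp_le hk.le _,
    Measurable.ite hEm hfm measurable_const, hG0, fun x => ?_, fun x y hxy => ?_, ?_, ?_⟩
  · simp only [hG]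
    split_ifs with h
    · linarith [hfE x h]
    · exact le_rfl
  · by_cases h : x ∈ E ∧ y ∈ E
    · beta_reduce
      rw [hvE x h.1, hvE y h.2]
      simpa only [hG, if_pos h.1, if_pos h.2] using hpairE x h.1 y h.2 hxy
    · have h1 := hvL.dist_le_mul x y
      rw [Real.dist_eq, Real.coe_toNNReal _ hlam0.le] at h1
      refine h1.trans ?_
      gcongr
      rw [not_and_or] at h
      rcases h with h | h
      · have : G x = 2 * lam := if_neg h
        linarith [hG0 y]
      · have : G y = 2 * lam := if_neg h
        linarith [hG0 x]
  · have h1 : eLpNorm (fun x => clamp k (v₀ x) - u x) p μ ≤ eLpNorm ((2 * k / lam) • f) p μ := by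
      refine eLpNorm_mono_ae_real ?_
      filter_upwards [hflt] with x hx
      rw [Real.norm_eq_abs, Pi.smul_apply, smul_eq_mul]
      by_cases hxE : x ∈ E
      · rw [hvE x hxE, sub_self, abs_zero]
        have : 0 ≤ f x := ENNReal.toReal_nonneg
        positivity
      · calc _ ≤ |clamp k (v₀ x)| + |u x| := abs_sub _ _
          _ ≤ 2 * k / lam * lam := by
            rw [div_mul_cancel₀ _ hlam0.ne']; linarith [abs_clamp_le hk.le (v₀ x), hu x]
          _ ≤ _ := by gcongr; exact (hx hxE).le
    rw [eLpNorm_const_smul] at h1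
    refine (h1.trans (mul_le_mul_right hfg _)).trans ?_
    rw [← ENNReal.ofReal_toReal hgp, ← hA, Real.enorm_eq_ofReal (by positivity),
      ← ENNReal.ofReal_mul (by positivity)]
    refine ENNReal.ofReal_le_ofReal ?_
    rw [div_mul_eq_mul_div, div_le_iff₀ hlam0]
    rw [div_le_iff₀ hδ] at hlam2
    linarith
  · have h1 : eLpNorm G p μ ≤ eLpNorm (f + {x | M ≤ ‖f x‖₊}.indicator f) p μ := by
      refine eLpNorm_mono_ae_real ?_
      filter_upwards [hflt] with x hx
      have h0 : 0 ≤ f x := ENNReal.toReal_nonneg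
      rw [Real.norm_of_nonneg (hG0 x), Pi.add_apply]
      simp only [hG]
      split_ifs with hxE
      · exact le_add_of_nonneg_right (Set.indicator_apply_nonneg fun _ => h0)
      · rw [Set.indicator_of_mem]
        · linarith [hx hxE]
        · simp only [Set.mem_ofPred_eq, coe_nnnorm, Real.norm_of_nonneg h0]
          exact (le_max_left _ _).trans (hx hxE).le
    refine h1.trans ((eLpNorm_add_le hfm.aestronglyMeasurable ?_ hp₁).trans (add_le_add hfg hM))
    refine (hfm.indicator ?_).aestronglyMeasurable
    exact measurableSet_le measurable_const hfm.nnnorm.subtype_coe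

end LipschitzTruncation

/-! ### Cutoffs and Lusin-type approximation -/

section Cutoff

variable {X : Type*} [MetricSpace X]

/-- The piecewise linear radial cutoff, equal to `1` on the ball of radius `R` and to `0` outside
the ball of radius `R + T`. -/
def cutoff (x₀ : X) (R T : ℝ) (x : X) : ℝ := max 0 (min 1 ((R + T - dist x x₀) / T))

variable {x₀ : X} {R T : ℝ}

theorem cutoff_nonneg (x : X) : 0 ≤ cutoff x₀ R T x := le_max_left _ _

theorem cutoff_le_one (x : X) : cutoff x₀ R T x ≤ 1 := max_le zero_le_one (min_le_left _ _)

theorem cutoff_eq_one (hT : 0 < T) {x : X} (h : dist x x₀ ≤ R) : cutoff x₀ R T x = 1 := by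
  have : 1 ≤ (R + T - dist x x₀) / T := by rw [le_div_iff₀ hT]; linarith
  rw [cutoff, min_eq_left this, max_eq_right zero_le_one]

theorem cutoff_eq_zero (hT : 0 < T) {x : X} (h : R + T ≤ dist x x₀) : cutoff x₀ R T x = 0 := by
  refine max_eq_left ((min_le_right _ _).trans ?_)
  exact div_nonpos_of_nonpos_of_nonneg (by linarith) hT.le

theorem abs_cutoff_sub_le (hT : 0 < T) (x y : X) :
    |cutoff x₀ R T x - cutoff x₀ R T y| ≤ dist x y / T := by
  have h0 : 0 ≤ dist x y / T := by positivity
  refine (abs_max_sub_max_le_max _ _ _ _).trans (max_le (by simpa using h0) ?_)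
  refine (abs_min_sub_min_le_max _ _ _ _).trans (max_le (by simpa using h0) ?_)
  rw [← sub_div, abs_div, abs_of_pos hT]
  gcongr
  rw [show R + T - dist x x₀ - (R + T - dist y x₀) = dist y x₀ - dist x x₀ by ring, dist_comm x y]
  exact abs_dist_sub_le _ _ _

theorem lipschitzWith_cutoff (hT : 0 < T) : LipschitzWith (1 / T).toNNReal (cutoff x₀ R T) := by
  refine LipschitzWith.of_dist_le_mul fun x y => ?_
  rw [Real.dist_eq, Real.coe_toNNReal _ (by positivity), one_div_mul_eq_div]
  exact abs_cutoff_sub_le hT x y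

/-- A Lipschitz function that vanishes on `K` and equals `1` away from `K`. -/
theorem exists_lipschitz_separating (K : Set X) {r : ℝ} (hr : 0 < r) :
    ∃ ψ : X → ℝ, (∃ M, LipschitzWith M ψ) ∧ (∀ x, 0 ≤ ψ x) ∧ (∀ x, ψ x ≤ 1) ∧
      (∀ x ∈ K, ψ x = 0) ∧ ∀ x, ψ x < 1 → ∃ y ∈ K, dist x y < r := by
  rcases K.eq_empty_or_nonempty with rfl | hK
  · exact ⟨fun _ => 1, ⟨0, LipschitzWith.const 1⟩, fun _ => zero_le_one, fun _ => le_rfl,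
      fun x hx => hx.elim, fun x hx => (lt_irrefl _ hx).elim⟩
  · refine ⟨fun x => min 1 (r⁻¹ * Metric.infDist x K), ⟨r⁻¹.toNNReal, ?_⟩,
      fun x => le_min zero_le_one (mul_nonneg (by positivity) Metric.infDist_nonneg),
      fun x => min_le_left _ _, fun x hx => ?_, fun x hx => ?_⟩
    · refine LipschitzWith.const_min (LipschitzWith.of_dist_le_mul fun x y => ?_) _
      rw [Real.coe_toNNReal _ (by positivity), Real.dist_eq, ← mul_sub, abs_mul,
        abs_of_pos (by positivity : 0 < r⁻¹)]
      gcongr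
      simpa [Real.dist_eq] using (Metric.lipschitz_infDist_pt K).dist_le_mul x y
    · beta_reduce
      rw [Metric.infDist_zero_of_mem hx]; simp
    · refine (Metric.infDist_lt_iff hK).1 ?_
      have : r⁻¹ * Metric.infDist x K < 1 := by
        simpa using hx
      rwa [inv_mul_lt_iff₀ hr, mul_one] at this

variable [MeasurableSpace X] [BorelSpace X] {μ : Measure X} {p : ℝ≥0∞}

/-- Reduction to bounded support, at a small cost in the gradient. -/
theorem exists_boundedSupport_approx (hp₁ : 1 ≤ p) (hp : p ≠ ∞) (x₀ : X) {v G : X → ℝ} {L : ℝ≥0}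
    {S k ε : ℝ} {δ : ℝ≥0∞} (hδ : 0 < δ) (hv : LipschitzWith L v) (hk : ∀ x, |v x| ≤ k)
    (hvp : MemLp v p μ) (hG : Measurable G) (hG0 : ∀ x, 0 ≤ G x) (hGS : ∀ x, G x ≤ S)
    (hpair : ∀ x y, dist x y ≤ ε → |v x - v y| ≤ (G x + G y) / 2 * dist x y) :
    ∃ (w H : X → ℝ) (L' : ℝ≥0) (S' R : ℝ), LipschitzWith L' w ∧ (∀ x, |w x| ≤ k) ∧
      (∀ x, R < dist x x₀ → w x = 0) ∧ Measurable H ∧ (∀ x, 0 ≤ H x) ∧ (∀ x, H x ≤ S') ∧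
      (∀ x y, dist x y ≤ ε → |w x - w y| ≤ (H x + H y) / 2 * dist x y) ∧
      eLpNorm (fun x => w x - v x) p μ ≤ δ ∧ eLpNorm H p μ ≤ eLpNorm G p μ + δ := by
  have hp₀ : p ≠ 0 := (zero_lt_one.trans_le hp₁).ne'
  have hTn : ∀ n : ℕ, (0 : ℝ) < n + 1 := fun n => by positivity
  have hvc := hv.continuous
  have hχc : ∀ n : ℕ, Continuous (cutoff x₀ (n + 1) (n + 1)) := fun n =>
    (lipschitzWith_cutoff (hTn n)).continuous
  have lim1 := tendsto_eLpNorm_zero_of_dominated hp₀ hp hvp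
    (F := fun (n : ℕ) x => cutoff x₀ (n + 1) (n + 1) x * v x - v x)
    (fun n => (((hχc n).mul hvc).sub hvc).aestronglyMeasurable)
    (fun n x => by
      rw [← sub_one_mul, abs_mul]
      refine mul_le_of_le_one_left (abs_nonneg _) ?_
      rw [abs_le]
      constructor <;> linarith [cutoff_nonneg (x₀ := x₀) (R := n + 1) (T := n + 1) x,
        cutoff_le_one (x₀ := x₀) (R := n + 1) (T := n + 1) x])
    (fun x => by
      refine tendsto_const_nhds.congr' ?_
      obtain ⟨N, hN⟩ := exists_nat_ge (dist x x₀)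
      filter_upwards [eventually_ge_atTop N] with n hn
      have : (N : ℝ) ≤ n := by exact_mod_cast hn
      rw [cutoff_eq_one (hTn n) (by linarith), one_mul, sub_self])
  have lim2 := tendsto_eLpNorm_zero_of_dominated hp₀ hp hvp
    (F := fun (n : ℕ) x => |v x| / (n + 1))
    (fun n => (hvc.abs.div_const _).aestronglyMeasurable)
    (fun n x => by
      rw [abs_div, abs_abs, abs_of_pos (hTn n)]
      exact div_le_self (abs_nonneg _) (by linarith [Nat.cast_nonneg (α := ℝ) n]))
    (fun x => tendsto_const_nhds.div_atTop
      (tendsto_atTop_add_const_right _ _ tendsto_natCast_atTop_atTop))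
  obtain ⟨n, hn1, hn2⟩ := ((lim1.eventually (eventually_le_nhds hδ)).and
    (lim2.eventually (eventually_le_nhds hδ))).exists
  set T : ℝ := n + 1 with hTdef
  have hT : 0 < T := hTn n
  set χ : X → ℝ := cutoff x₀ T T with hχ
  have hχ0 : ∀ x, 0 ≤ χ x := cutoff_nonneg
  have hχ1 : ∀ x, χ x ≤ 1 := cutoff_le_one
  have prod : ∀ x y, |χ x * v x - χ y * v y| ≤
      |v x - v y| + dist x y / T * ((|v x| + |v y|) / 2) := by
    intro x y
    -- The symmetric product rule yields the mean of `|v|` at the two points, so `|v| / T` is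
    -- exactly the term to add to the gradient.
    have e : χ x * v x - χ y * v y =
        (χ x + χ y) / 2 * (v x - v y) + (χ x - χ y) * ((v x + v y) / 2) := by ring
    rw [e]
    refine (abs_add_le _ _).trans (add_le_add ?_ ?_)
    · rw [abs_mul]
      refine mul_le_of_le_one_left (abs_nonneg _) ?_
      rw [abs_of_nonneg (by linarith [hχ0 x, hχ0 y])]
      linarith [hχ1 x, hχ1 y]
    · rw [abs_mul]
      gcongr
      · exact abs_cutoff_sub_le hT x y
      · rw [abs_div, abs_two]
        gcongr
        exact abs_add_le _ _
  refine ⟨fun x => χ x * v x, fun x => G x + |v x| / T, L + (k / T).toNNReal, S + k / T, T + T,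
    LipschitzWith.of_dist_le_mul fun x y => ?_, fun x => ?_, fun x hx => ?_,
    hG.add (hvc.abs.div_const _).measurable, fun x => ?_, fun x => ?_, fun x y hxy => ?_, hn1, ?_⟩
  · have hk0 : 0 ≤ k := (abs_nonneg _).trans (hk x)
    have h1 := hv.dist_le_mul x y
    rw [Real.dist_eq] at h1
    rw [Real.dist_eq, NNReal.coe_add, Real.coe_toNNReal _ (by positivity), add_mul]
    refine (prod x y).trans (add_le_add h1 ?_)
    rw [div_mul_eq_mul_div, div_mul_eq_mul_div, mul_comm]
    gcongr
    linarith [hk x, hk y]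
  · rw [abs_mul, abs_of_nonneg (hχ0 x)]
    exact (mul_le_of_le_one_left (abs_nonneg _) (hχ1 x)).trans (hk x)
  · have : χ x = 0 := cutoff_eq_zero hT hx.le
    simp [this]
  · have := hG0 x
    positivity
  · have := hk x
    have := hGS x
    beta_reduce
    gcongr
  · refine (prod x y).trans ?_
    have := hpair x y hxy
    calc _ ≤ (G x + G y) / 2 * dist x y + dist x y / T * ((|v x| + |v y|) / 2) := by gcongr
      _ = _ := by ring
  · exact (eLpNorm_add_le hG.aestronglyMeasurable (hvc.abs.div_const _).aestronglyMeasurable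
      hp₁).trans (add_le_add le_rfl hn2)

/-- A Lusin-type approximation of a bounded Borel function by a Lipschitz function from above. -/
theorem exists_compact_lipschitz_approx [CompleteSpace X] [TopologicalSpace.SeparableSpace X]
    {G : X → ℝ} {S η : ℝ} {B : Set X} {κ : ℝ≥0∞} (hG : Measurable G) (hG0 : ∀ x, 0 ≤ G x)
    (hGS : ∀ x, G x ≤ S) (hS : 0 ≤ S) (hB : MeasurableSet B) (hμB : μ B ≠ ∞) (hη : 0 < η)
    (hκ : κ ≠ 0) :
    ∃ K ⊆ B, IsCompact K ∧ μ (B \ K) ≤ κ ∧ ∃ f : X → ℝ, (∃ M, LipschitzWith M f) ∧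
      (∀ x, 0 ≤ f x) ∧ (∀ x, f x ≤ S + η) ∧ ∀ x ∈ K, G x ≤ f x ∧ f x ≤ G x + η := by
  have := UniformSpace.secondCountable_of_separable X
  set N : X → ℕ := fun x => ⌊G x / η⌋₊ with hN
  have hNm : Measurable N := Nat.measurable_floor.comp (hG.div_const η)
  have hNlo : ∀ x, η * N x ≤ G x := fun x => by
    have := Nat.floor_le (div_nonneg (hG0 x) hη.le)
    rw [le_div_iff₀ hη] at this
    linarith
  have hNhi : ∀ x, G x ≤ η * (N x + 1) := fun x => by
    have := (Nat.lt_floor_add_one (G x / η)).le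
    rw [div_le_iff₀ hη] at this
    linarith
  set m : ℕ := ⌊S / η⌋₊ + 1 with hm
  have hNm' : ∀ x, N x < m := fun x =>
    Nat.lt_succ_of_le (Nat.floor_le_floor (div_le_div_of_nonneg_right (hGS x) hη.le))
  have hκ' : κ / m ≠ 0 := ENNReal.div_ne_zero.2 ⟨hκ, ENNReal.natCast_ne_top m⟩
  have hA : ∀ j, MeasurableSet (B ∩ N ⁻¹' {j}) := fun j =>
    hB.inter (hNm (measurableSet_singleton j))
  choose K hKA hKc hKμ using fun j => (hA j).exists_isCompact_sdiff_lt (μ := μ)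
    (measure_ne_top_of_subset Set.inter_subset_left hμB) hκ'
  have hKN : ∀ {j x}, x ∈ K j → N x = j := fun hx => (hKA _ hx).2
  set K' : Set X := ⋃ j ∈ Finset.range m, K j with hK'
  have hK'c : IsCompact K' := (Finset.range m).isCompact_biUnion fun j _ => hKc j
  have memK' : ∀ {x}, x ∈ K' → x ∈ K (N x) := by
    intro x hx
    simp only [hK', Set.mem_iUnion] at hx
    obtain ⟨j, _, hx⟩ := hx
    rwa [hKN hx]
  -- The finitely many compact pieces are disjoint, so `N` is locally constant on their union; by
  -- compactness it is constant at a uniform scale, whence the constant `S := 0` in `hlip`.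
  have hcont : ContinuousOn (fun x => (N x : ℝ)) K' := by
    intro x hx
    refine tendsto_nhds_of_eventually_eq ?_
    have hcl : IsClosed (⋃ j ∈ (Finset.range m).erase (N x), K j) :=
      (((Finset.range m).erase (N x)).isCompact_biUnion fun j _ => hKc j).isClosed
    have hx' : x ∈ (⋃ j ∈ (Finset.range m).erase (N x), K j)ᶜ := by
      simp only [Set.mem_compl_iff, Set.mem_iUnion, not_exists]
      exact fun j hj hxj => (Finset.mem_erase.1 hj).1 (hKN hxj).symm
    filter_upwards [mem_nhdsWithin_of_mem_nhds (hcl.isOpen_compl.mem_nhds hx'),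
      self_mem_nhdsWithin] with y hy hyK
    by_contra hne
    refine hy ?_
    simp only [Set.mem_iUnion]
    refine ⟨N y, Finset.mem_erase.2 ⟨fun h => hne (by rw [h]), Finset.mem_range.2 (hNm' y)⟩,
      memK' hyK⟩
  obtain ⟨r, hr, hloc⟩ := Metric.uniformContinuousOn_iff.1
    (hK'c.uniformContinuousOn_of_continuous hcont) 1 one_pos
  have hlip := lipschitzOnWith_of_local (f := fun x => η * ((N x : ℝ) + 1)) (s := K') (S := 0)
    (B := S + η) (half_pos hr) (fun x _ => by
      rw [abs_of_nonneg (by positivity)]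
      linarith [hNlo x, hGS x]) (fun x hx y hy hxy => by
      have h1 := hloc x hx y hy (by linarith)
      rw [Nat.dist_cast_real, Nat.dist_eq] at h1
      have h2 : N x = N y := by
        have : |(N x : ℤ) - N y| < 1 := by exact_mod_cast h1
        have := Int.abs_lt_one_iff.1 this
        omega
      simp [h2])
  obtain ⟨f, hf, hfK⟩ := hlip.extend_real
  refine ⟨K', ?_, hK'c, ?_, fun x => max 0 (min (S + η) (f x)),
    ⟨_, (hf.const_min _).const_max _⟩, fun x => le_max_left _ _,
    fun x => max_le (by linarith) (min_le_left _ _), fun x hx => ?_⟩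
  · exact Set.iUnion₂_subset fun j _ => (hKA j).trans Set.inter_subset_left
  · calc μ (B \ K') ≤ μ (⋃ j ∈ Finset.range m, (B ∩ N ⁻¹' {j}) \ K j) := by
          refine measure_mono fun x hx => ?_
          simp only [Set.mem_iUnion]
          refine ⟨N x, Finset.mem_range.2 (hNm' x), ⟨hx.1, rfl⟩, fun h => hx.2 ?_⟩
          simp only [hK', Set.mem_iUnion]
          exact ⟨N x, Finset.mem_range.2 (hNm' x), h⟩
      _ ≤ ∑ j ∈ Finset.range m, μ ((B ∩ N ⁻¹' {j}) \ K j) := measure_biUnion_finset_le _ _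
      _ ≤ ∑ _j ∈ Finset.range m, κ / m := Finset.sum_le_sum fun j _ => (hKμ j).le
      _ ≤ κ := by
          rw [Finset.sum_const, Finset.card_range, nsmul_eq_mul]
          exact ENNReal.mul_div_le
  · have e : f x = η * ((N x : ℝ) + 1) := (hfK hx).symm
    have h1 : f x ≤ G x + η := by rw [e]; linarith [hNlo x]
    have h2 : G x ≤ f x := by rw [e]; exact hNhi x
    beta_reduce
    rw [min_eq_right (by linarith [hGS x]), max_eq_right ((hG0 x).trans h2)]
    exact ⟨h2, h1⟩

end Cutoff

/-! ### Lipschitz gradients at one scale, and the approximation theorem -/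

section Approximation

theorem exists_pos_ofReal_mul_le {b : ℝ≥0∞} (hb : b ≠ ∞) {δ : ℝ≥0∞} (hδ : 0 < δ) :
    ∃ η : ℝ, 0 < η ∧ η ≤ 1 ∧ ENNReal.ofReal η * b ≤ δ := by
  have h : Tendsto (fun η : ℝ => ENNReal.ofReal η * b) (𝓝[>] 0) (𝓝 0) := by
    have h1 : Tendsto (fun η : ℝ => ENNReal.ofReal η) (𝓝[>] 0) (𝓝 0) := by
      simpa using (ENNReal.continuous_ofReal.tendsto 0).mono_left nhdsWithin_le_nhds
    simpa using ENNReal.Tendsto.mul_const h1 (Or.inr hb)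
  obtain ⟨η, h1, h2, h3⟩ := ((h.eventually (eventually_le_nhds hδ)).and
    (((eventually_le_nhds (zero_lt_one (α := ℝ))).filter_mono nhdsWithin_le_nhds).and
      self_mem_nhdsWithin)).exists
  exact ⟨η, h3, h2, h1⟩

variable {X : Type*} [MetricSpace X] [CompleteSpace X] [TopologicalSpace.SeparableSpace X]
  [MeasurableSpace X] [BorelSpace X] {μ : Measure X} {p : ℝ≥0∞}

/-- A Lipschitz function `h`, with norm close to that of a given gradient `G` and bounded
independently of the scale `τ`, that controls the oscillation of `v` at scale `τ`. -/
theorem exists_lipschitz_scale_gradient (hμ : ∀ s : Set X, Bornology.IsBounded s → μ s < ∞)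
    (hp₁ : 1 ≤ p) (hp : p ≠ ∞) {x₀ : X} {v G : X → ℝ} {L : ℝ≥0} {S R ε τ : ℝ} {δ : ℝ≥0∞}
    (hδ : 0 < δ) (hv : LipschitzWith L v) (hR : ∀ x, R < dist x x₀ → v x = 0)
    (hG : Measurable G) (hG0 : ∀ x, 0 ≤ G x) (hGS : ∀ x, G x ≤ S)
    (hpair : ∀ x y, dist x y ≤ ε → |v x - v y| ≤ (G x + G y) / 2 * dist x y)
    (hτ : 0 < τ) (hτε : τ < ε) :
    ∃ (h : X → ℝ) (ρ : ℝ), 0 < ρ ∧ (∃ M, LipschitzWith M h) ∧ (∀ x, 0 ≤ h x) ∧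
      (∀ x, h x ≤ S + 2 + 4 * L) ∧
      (∀ x y, dist x y ≤ τ + ρ → |v x - v y| ≤ τ * ((h x + h y) / 2)) ∧
      eLpNorm h p μ ≤ eLpNorm G p μ + (δ + δ) := by
  have hp₀ : p ≠ 0 := (zero_lt_one.trans_le hp₁).ne'
  have hpos : 0 < p.toReal := ENNReal.toReal_pos hp₀ hp
  have hε : 0 < ε := hτ.trans hτε
  have hS : 0 ≤ S := (hG0 x₀).trans (hGS x₀)
  have hL : (0 : ℝ) ≤ L := L.coe_nonneg
  set S' : ℝ := S + 2 + 4 * L with hS'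
  have hS'0 : 0 < S' := by positivity
  set B : Set X := Metric.closedBall x₀ (R + 2 * ε + 1) with hB
  have hBm : MeasurableSet B := Metric.isClosed_closedBall.measurableSet
  have hμB : μ B ≠ ∞ := (hμ B Metric.isBounded_closedBall).ne
  obtain ⟨η, hη, hη1, hηδ⟩ := exists_pos_ofReal_mul_le (b := 2 * μ B ^ (1 / p.toReal))
    (ENNReal.mul_ne_top (by simp) (ENNReal.rpow_ne_top_of_nonneg (by positivity) hμB)) hδ
  have hκ : (δ / ENNReal.ofReal S') ^ p.toReal ≠ 0 := by
    have : δ / ENNReal.ofReal S' ≠ 0 := ENNReal.div_ne_zero.2 ⟨hδ.ne', ENNReal.ofReal_ne_top⟩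
    exact (ENNReal.rpow_pos_of_nonneg (pos_iff_ne_zero.2 this) hpos.le).ne'
  obtain ⟨K, -, hKc, hμK, f, ⟨M, hf⟩, hf0, hfS, hfK⟩ :=
    exists_compact_lipschitz_approx (μ := μ) hG hG0 hGS hS hBm hμB hη hκ
  -- `ρ` is chosen after `K` and `f`, so it may depend on `M`. Moving both points to `K` costs `2 *
  -- L * ρ` in `v`, `3 * S * ρ` from the longer distance and `τ * M * ρ` in `f`: in total at most `τ
  -- * η`.
  set D : ℝ := 2 * L + 3 * S + τ * M + 1 with hD
  have hD0 : 0 < D := by positivity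
  set ρ : ℝ := min τ (min ((ε - τ) / 3) (τ * η / D)) with hρdef
  have hρ : 0 < ρ := lt_min hτ (lt_min (by linarith) (by positivity))
  have hρ1 : ρ ≤ τ := min_le_left _ _
  have hρ2 : ρ ≤ (ε - τ) / 3 := (min_le_right _ _).trans (min_le_left _ _)
  have hρ3 : ρ * D ≤ τ * η := by
    rw [← le_div_iff₀ hD0]
    exact (min_le_right _ _).trans (min_le_right _ _)
  obtain ⟨ψ, ⟨Mψ, hψ⟩, hψ0, hψ1, hψK, hψsep⟩ := exists_lipschitz_separating K hρ
  set χ : X → ℝ := cutoff x₀ (R + 2 * ε) 1 with hχ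
  have hχlip : LipschitzWith (1 / 1 : ℝ).toNNReal χ := lipschitzWith_cutoff one_pos
  have smul : ∀ {c : ℝ} {k : X → ℝ} {M : ℝ≥0}, 0 ≤ c → LipschitzWith M k →
      LipschitzWith (c.toNNReal * M) fun x => c * k x := by
    intro c k M hc hk
    refine LipschitzWith.of_dist_le_mul fun x y => ?_
    rw [Real.dist_eq, ← mul_sub, abs_mul, abs_of_nonneg hc, NNReal.coe_mul,
      Real.coe_toNNReal _ hc, mul_assoc]
    gcongr
    simpa [Real.dist_eq] using hk.dist_le_mul x y
  -- `η` absorbs the cost of moving to `K`. If a point is not within `ρ` of `K`, then `ψ = 1` there,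
  -- and `4 * L` covers the Lipschitz bound `L * (τ + ρ) ≤ 2 * L * τ`. Since `ψ = 0` on `K`, this
  -- term costs norm only on `B \ K`, whose measure is small.
  set h₀ : X → ℝ := fun x => f x + η + 4 * L * ψ x with hh₀
  have hh₀0 : ∀ x, 0 ≤ h₀ x := fun x => by
    have := hf0 x
    have := hψ0 x
    positivity
  have hh₀S : ∀ x, h₀ x ≤ S' := fun x => by
    have h1 : 4 * L * ψ x ≤ 4 * L := mul_le_of_le_one_right (by positivity) (hψ1 x)
    simp only [hh₀, hS']
    linarith [hfS x]
  set h : X → ℝ := fun x => min (h₀ x) (S' * χ x) with hh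
  have hh0 : ∀ x, 0 ≤ h x := fun x => le_min (hh₀0 x) (mul_nonneg hS'0.le (cutoff_nonneg x))
  have hhin : ∀ x, dist x x₀ ≤ R + 2 * ε → h x = h₀ x := fun x hx => by
    simp only [hh, hχ]
    rw [cutoff_eq_one one_pos hx, mul_one, min_eq_left (hh₀S x)]
  have hhout : ∀ x, x ∉ B → h x = 0 := fun x hx => by
    have hx' : R + 2 * ε + 1 ≤ dist x x₀ := by
      rw [hB, Metric.mem_closedBall, not_le] at hx; exact hx.le
    simp only [hh, hχ]
    rw [cutoff_eq_zero one_pos hx', mul_zero, min_eq_right (hh₀0 x)]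
  have hhL : ∃ M, LipschitzWith M h :=
    ⟨_, ((hf.add (LipschitzWith.const η)).add (smul (by positivity) hψ)).min (smul hS'0.le hχlip)⟩
  refine ⟨h, ρ, hρ, hhL, hh0, fun x => (min_le_left _ _).trans (hh₀S x), fun x y hxy => ?_, ?_⟩
  · by_cases hxy0 : R < dist x x₀ ∧ R < dist y x₀
    · rw [hR x hxy0.1, hR y hxy0.2, sub_self, abs_zero]
      have := hh0 x
      have := hh0 y
      positivity
    have hin : dist x x₀ ≤ R + 2 * ε ∧ dist y x₀ ≤ R + 2 * ε := by
      rw [not_and_or, not_lt, not_lt] at hxy0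
      have h1 := dist_triangle x y x₀
      have h2 := dist_triangle y x x₀
      rw [dist_comm y x] at h2
      rcases hxy0 with h3 | h3 <;> constructor <;> linarith
    rw [hhin x hin.1, hhin y hin.2]
    by_cases hψxy : ψ x < 1 ∧ ψ y < 1
    · obtain ⟨x', hx', hxx'⟩ := hψsep x hψxy.1
      obtain ⟨y', hy', hyy'⟩ := hψsep y hψxy.2
      have hd : dist x' y' ≤ τ + 3 * ρ := by
        have h1 := dist_triangle4 x' x y y'
        rw [dist_comm x' x] at h1
        linarith
      have hvx : |v x - v x'| ≤ L * ρ := by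
        rw [← Real.dist_eq]
        exact (hv.dist_le_mul x x').trans (by gcongr)
      have hvy : |v y - v y'| ≤ L * ρ := by
        rw [← Real.dist_eq]
        exact (hv.dist_le_mul y y').trans (by gcongr)
      have hfx : f x' ≤ f x + M * ρ := by
        have h1 := (hf.dist_le_mul x' x)
        rw [Real.dist_eq, dist_comm] at h1
        have h2 : (M : ℝ) * dist x x' ≤ M * ρ := by gcongr
        linarith [le_abs_self (f x' - f x)]
      have hfy : f y' ≤ f y + M * ρ := by
        have h1 := (hf.dist_le_mul y' y)
        rw [Real.dist_eq, dist_comm] at h1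
        have h2 : (M : ℝ) * dist y y' ≤ M * ρ := by gcongr
        linarith [le_abs_self (f y' - f y)]
      have hvv : |v x' - v y'| ≤ (G x' + G y') / 2 * (τ + 3 * ρ) := by
        refine (hpair x' y' (by linarith)).trans ?_
        have := hG0 x'
        have := hG0 y'
        gcongr
      have h3 : (G x' + G y') / 2 * (3 * ρ) ≤ S * (3 * ρ) := by
        gcongr
        linarith [hGS x', hGS y']
      have h4 : (G x' + G y') / 2 * τ ≤ ((f x + f y) / 2 + M * ρ) * τ := by
        gcongr
        linarith [(hfK x' hx').1, (hfK y' hy').1]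
      have h5 : |v x - v y| ≤ |v x - v x'| + |v x' - v y'| + |v y - v y'| := by
        have h6 := abs_sub_le (v x) (v x') (v y)
        have h7 := abs_sub_le (v x') (v y') (v y)
        rw [abs_sub_comm (v y') (v y)] at h7
        linarith
      have h8 : τ * ((h₀ x + h₀ y) / 2) =
          τ * ((f x + f y) / 2) + τ * η + τ * (4 * L * (ψ x + ψ y) / 2) := by
        simp only [hh₀]; ring
      have h9 : 0 ≤ τ * (4 * L * (ψ x + ψ y) / 2) := by
        have := hψ0 x
        have := hψ0 y
        positivity
      rw [h8]
      rw [hD] at hρ3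
      linarith
    · have h1 : 4 * L ≤ h₀ x + h₀ y := by
        have e : h₀ x + h₀ y = f x + f y + 2 * η + 4 * L * (ψ x + ψ y) := by
          simp only [hh₀]; ring
        have h2 : 1 ≤ ψ x + ψ y := by
          rw [not_and_or, not_lt, not_lt] at hψxy
          rcases hψxy with h3 | h3 <;> linarith [hψ0 x, hψ0 y]
        have h3 : 4 * L * 1 ≤ 4 * L * (ψ x + ψ y) := by gcongr
        linarith [hf0 x, hf0 y]
      have h2 := hv.dist_le_mul x y
      rw [Real.dist_eq] at h2
      calc |v x - v y| ≤ L * dist x y := h2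
        _ ≤ L * (τ + τ) := by gcongr; linarith
        _ = τ * (4 * L / 2) := by ring
        _ ≤ τ * ((h₀ x + h₀ y) / 2) := by gcongr
  · have hKm : MeasurableSet (B \ K) := by
      exact hBm.diff hKc.isClosed.measurableSet
    have h1 : eLpNorm h p μ ≤ eLpNorm (G + (B.indicator (fun _ => 2 * η) +
        (B \ K).indicator fun _ => S')) p μ := by
      refine eLpNorm_mono_real fun x => ?_
      rw [Real.norm_of_nonneg (hh0 x)]
      simp only [Pi.add_apply]
      by_cases hxB : x ∈ B
      · rw [Set.indicator_of_mem hxB]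
        by_cases hxK : x ∈ K
        · rw [Set.indicator_of_notMem (fun hx => hx.2 hxK)]
          refine (min_le_left _ _).trans ?_
          simp only [hh₀, hψK x hxK]
          linarith [(hfK x hxK).2]
        · rw [Set.indicator_of_mem (show x ∈ B \ K from ⟨hxB, hxK⟩)]
          linarith [(min_le_left (h₀ x) (S' * χ x)).trans (hh₀S x), hG0 x]
      · rw [hhout x hxB, Set.indicator_of_notMem hxB, Set.indicator_of_notMem (fun hx => hxB hx.1)]
        simpa using hG0 x
    refine h1.trans ((eLpNorm_add_le hG.aestronglyMeasurable
      ((measurable_const.indicator hBm).add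
        (measurable_const.indicator hKm)).aestronglyMeasurable hp₁).trans
      (add_le_add le_rfl ((eLpNorm_add_le (measurable_const.indicator hBm).aestronglyMeasurable
        (measurable_const.indicator hKm).aestronglyMeasurable hp₁).trans (add_le_add ?_ ?_))))
    · refine (eLpNorm_indicator_const_le _ _).trans (le_trans (le_of_eq ?_) hηδ)
      rw [Real.enorm_eq_ofReal (by positivity), mul_comm 2 η, ENNReal.ofReal_mul hη.le, mul_assoc]
      simp
    · refine (eLpNorm_indicator_const_le _ _).trans ?_
      rw [Real.enorm_eq_ofReal hS'0.le]
      calc _ ≤ ENNReal.ofReal S' * ((δ / ENNReal.ofReal S') ^ p.toReal) ^ (1 / p.toReal) := by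
            gcongr
        _ = ENNReal.ofReal S' * (δ / ENNReal.ofReal S') := by
            rw [← ENNReal.rpow_mul, mul_one_div_cancel hpos.ne', ENNReal.rpow_one]
        _ ≤ δ := ENNReal.mul_div_le

/-- Every `p`-integrable function with an `ε`-upper gradient in `L^p` is approximated, in energy, by
Lipschitz functions with Lipschitz chain upper gradients. -/
theorem exists_lipschitz_approx (hμ : ∀ s : Set X, Bornology.IsBounded s → μ s < ∞)
    (hp₁ : 1 ≤ p) (hp : p ≠ ∞) {u : X → ℝ} (hu : MemLp u p μ) {g : X → ℝ≥0∞} {ε : ℝ}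
    (hε : 0 < ε) (hg : g ∈ UG ε u) (hgp : eLpNorm g p μ ≠ ∞) {δ : ℝ} (hδ : 0 < δ) :
    ∃ (w : X → ℝ) (g' : X → ℝ≥0∞) (ρ : ℝ), MemLp w p μ ∧ (∃ K : ℝ≥0, LipschitzWith K w) ∧ 0 < ρ ∧
      g' ∈ LUG ρ w ∧ eLpNorm (w - u) p μ ≤ 4 * ENNReal.ofReal δ ∧
      eLpNorm g' p μ ≤ eLpNorm g p μ + 4 * ENNReal.ofReal δ := by
  have hp₀ : p ≠ 0 := (zero_lt_one.trans_le hp₁).ne'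
  have hδ' : 0 < ENNReal.ofReal δ := ENNReal.ofReal_pos.2 hδ
  rcases isEmpty_or_nonempty X with hX | ⟨⟨x₀⟩⟩
  · refine ⟨u, fun _ => 0, 1, hu, ⟨0, LipschitzWith.of_dist_le_mul fun x => hX.elim x⟩, one_pos,
      ⟨mem_UG_iff.2 ⟨measurable_const, fun x => hX.elim x⟩, fun _ => 0, ⟨0, LipschitzWith.const 0⟩,
        by simp⟩, by simp, by simp⟩
  rw [mem_UG_iff] at hg
  obtain ⟨hgm, hgpair⟩ := hg
  obtain ⟨k, hk, huk⟩ := exists_clamp_close hp₀ hp hu hδ'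
  obtain ⟨v, G, L, S, hvL, hvk, hGm, hG0, hGS, hGpair, hvu, hGg⟩ :=
    exists_lipschitz_truncation (μ := μ) (u := fun x => clamp k (u x)) hp₁ hp hε hk hδ
      (fun x => abs_clamp_le hk.le _) hgm hgp fun x y hxy =>
        (ENNReal.ofReal_le_ofReal (abs_clamp_sub_clamp_le _ _ _)).trans (hgpair x y hxy)
  have hum : AEStronglyMeasurable (fun x => clamp k (u x)) μ :=
    (continuous_clamp k).comp_aestronglyMeasurable hu.1
  have hvp : MemLp v p μ := by
    have h1 : MemLp (fun x => clamp k (u x) - u x) p μ :=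
      ⟨hum.sub hu.1, huk.trans_lt ENNReal.ofReal_lt_top⟩
    have h2 : MemLp (fun x => v x - clamp k (u x)) p μ :=
      ⟨hvL.continuous.aestronglyMeasurable.sub hum, hvu.trans_lt ENNReal.ofReal_lt_top⟩
    refine ((h2.add h1).add hu).ae_eq (ae_of_all _ fun x => ?_)
    simp
  obtain ⟨v', H, L', S', R, hv'L, hv'k, hR, hHm, hH0, hHS, hHpair, hv'v, hHG⟩ :=
    exists_boundedSupport_approx hp₁ hp x₀ hδ' hvL hvk hvp hGm hG0 hGS hGpair
  set B : Set X := Metric.closedBall x₀ R with hB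
  have hBm : MeasurableSet B := Metric.isClosed_closedBall.measurableSet
  have hμB : μ B ≠ ∞ := (hμ B Metric.isBounded_closedBall).ne
  set S'' : ℝ := S' + 2 + 4 * L' with hS''
  have hS''0 : 0 ≤ S'' := by
    have := (hH0 x₀).trans (hHS x₀)
    positivity
  -- `S''` bounds every `h` produced below, whatever the scale; so `τ ≤ η` can be fixed before `h`
  -- to make the envelope error `τ * S''` on `B` small.
  obtain ⟨η, hη, hη1, hηδ⟩ := exists_pos_ofReal_mul_le
    (b := ENNReal.ofReal S'' * μ B ^ (1 / p.toReal))
    (ENNReal.mul_ne_top (by simp) (ENNReal.rpow_ne_top_of_nonneg (by positivity) hμB)) hδ'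
  set τ : ℝ := min η (ε / 2) with hτdef
  have hτ : 0 < τ := lt_min hη (half_pos hε)
  have hτε : τ < ε := (min_le_right _ _).trans_lt (half_lt_self hε)
  obtain ⟨h, ρ, hρ, ⟨M, hhM⟩, hh0, hhS, hhQ, hhp⟩ := exists_lipschitz_scale_gradient hμ hp₁ hp hδ'
    hv'L hR hHm hH0 hHS hHpair hτ hτε
  obtain ⟨w, hwL, hwpair, hwv, hw0⟩ := exists_lipschitz_pair_of_scale hρ hτ hh0 hhS hv'k hhQ
  have hwm : AEStronglyMeasurable w μ := hwL.choose_spec.continuous.aestronglyMeasurable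
  have hwv' : eLpNorm (fun x => w x - v' x) p μ ≤ ENNReal.ofReal δ := by
    have h1 : eLpNorm (fun x => w x - v' x) p μ ≤ eLpNorm (B.indicator fun _ => η * S'') p μ := by
      refine eLpNorm_mono_real fun x => ?_
      rw [Real.norm_eq_abs]
      by_cases hx : x ∈ B
      · rw [Set.indicator_of_mem hx]
        exact (hwv x).trans (by gcongr; exact min_le_left _ _)
      · have hx' : v' x = 0 := hR x (by rwa [hB, Metric.mem_closedBall, not_le] at hx)
        rw [Set.indicator_of_notMem hx, hw0 x hx', hx']
        simp
    refine h1.trans ((eLpNorm_indicator_const_le _ _).trans (le_trans (le_of_eq ?_) hηδ))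
    rw [Real.enorm_eq_ofReal (by positivity), ENNReal.ofReal_mul hη.le, mul_assoc]
  have hclose : eLpNorm (w - u) p μ ≤ 4 * ENNReal.ofReal δ := by
    have e : w - u = (((fun x => w x - v' x) + fun x => v' x - v x) +
        fun x => v x - clamp k (u x)) + fun x => clamp k (u x) - u x := by
      ext x; simp
    have m1 := hwm.sub (hv'L.continuous.aestronglyMeasurable (μ := μ))
    have m2 := (hv'L.continuous.aestronglyMeasurable (μ := μ)).sub
      (hvL.continuous.aestronglyMeasurable (μ := μ))
    have m3 := (hvL.continuous.aestronglyMeasurable (μ := μ)).sub hum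
    rw [e]
    refine (eLpNorm_add_le ((m1.add m2).add m3) (hum.sub hu.1) hp₁).trans ?_
    refine (add_le_add ((eLpNorm_add_le (m1.add m2) m3 hp₁).trans
      (add_le_add ((eLpNorm_add_le m1 m2 hp₁).trans (add_le_add hwv' hv'v)) hvu)) huk).trans ?_
    ring_nf
    exact le_rfl
  refine ⟨w, fun x => ((h x).toNNReal : ℝ≥0∞), ρ, ?_, hwL, hρ, ⟨mem_UG_iff.2 ⟨?_, fun x y hxy => ?_⟩,
    fun x => (h x).toNNReal, ⟨_, Real.lipschitzWith_toNNReal.comp hhM⟩, rfl⟩, hclose, ?_⟩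
  · have h1 : MemLp (w - u) p μ := ⟨hwm.sub hu.1, hclose.trans_lt (by finiteness)⟩
    simpa using h1.add hu
  · exact hhM.continuous.measurable.real_toNNReal.coe_nnreal_ennreal
  · have h1 := ENNReal.ofReal_le_ofReal (hwpair x y hxy)
    rwa [ENNReal.ofReal_mul (by linarith [hh0 x, hh0 y]), ENNReal.ofReal_div_of_pos two_pos,
      ENNReal.ofReal_add (hh0 x) (hh0 y), ENNReal.ofReal_ofNat, ← edist_dist] at h1
  · have h1 : eLpNorm (fun x => ((h x).toNNReal : ℝ≥0∞)) p μ ≤ eLpNorm h p μ := by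
      refine eLpNorm_mono_enorm fun x => ?_
      rw [enorm_eq_self, Real.enorm_eq_ofReal (hh0 x)]
      exact le_rfl
    calc _ ≤ eLpNorm G p μ + ENNReal.ofReal δ + (ENNReal.ofReal δ + ENNReal.ofReal δ) :=
          h1.trans (hhp.trans (by gcongr))
      _ ≤ eLpNorm g p μ + ENNReal.ofReal δ + ENNReal.ofReal δ +
          (ENNReal.ofReal δ + ENNReal.ofReal δ) := by gcongr
      _ = _ := by ring

end Approximation

/-! ### Passing to the relaxations -/

section Relaxation

theorem relaxation_mono {X : Type*} [MeasurableSpace X] {μ : Measure X} {p : ℝ≥0∞}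
    {F F' : (X → ℝ) → ℝ≥0∞} (h : ∀ v, F v ≤ F' v)
    (u : Lp ℝ p μ) :
    relaxation p μ F u ≤ relaxation p μ F' u :=
  iInf₂_mono fun _ _ => liminf_le_liminf (Eventually.of_forall fun _ => h _)

variable {X : Type*} [MetricSpace X] [MeasurableSpace X] {μ : Measure X} {p : ℝ≥0∞}

theorem chainEnergy_le_eLpNorm {u : X → ℝ} {g : X → ℝ≥0∞} {ε : ℝ} (hε : 0 < ε) (hg : g ∈ UG ε u) :
    chainEnergy p μ u ≤ eLpNorm g p μ :=
  (iInf₂_le ε hε).trans (iInf₂_le g hg)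

theorem lipChainEnergy_le_eLpNorm {u : X → ℝ} (hu : ∃ K : ℝ≥0, LipschitzWith K u) {g : X → ℝ≥0∞}
    {ε : ℝ} (hε : 0 < ε) (hg : g ∈ LUG ε u) : lipChainEnergy p μ u ≤ eLpNorm g p μ := by
  rw [lipChainEnergy, if_pos hu]
  exact (iInf₂_le ε hε).trans (iInf₂_le g hg)

theorem chainEnergy_le_lipChainEnergy (u : X → ℝ) :
    chainEnergy p μ u ≤ lipChainEnergy p μ u := by
  rw [lipChainEnergy]
  split_ifs
  · exact iInf₂_mono fun ε _ => biInf_mono fun _ hg => hg.1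
  · exact le_top

variable [CompleteSpace X] [TopologicalSpace.SeparableSpace X] [BorelSpace X]

/-- Diagonal choice: take a near-optimal competitor and a near-optimal gradient for it, then replace
the pair by a Lipschitz one. Shrinking the scale of a gradient is free, so the scales can be forced
to `0`. -/
theorem exists_lipschitz_recovery_seq (hμ : ∀ s : Set X, Bornology.IsBounded s → μ s < ∞)
    (hp₁ : 1 ≤ p) (hp : p ≠ ∞) (u : Lp ℝ p μ) (hu : relaxation p μ (chainEnergy p μ) u < ∞) :
    ∃ (v : ℕ → X → ℝ) (ε : ℕ → ℝ) (g : ℕ → X → ℝ≥0∞),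
      (∀ j, MemLp (v j) p μ ∧ (∃ K : ℝ≥0, LipschitzWith K (v j)) ∧
        0 < ε j ∧ g j ∈ LUG (ε j) (v j)) ∧
      Tendsto ε atTop (𝓝 0) ∧
      Tendsto (fun j => eLpNorm (v j - ⇑u) p μ) atTop (𝓝 0) ∧
      Tendsto (fun j => eLpNorm (g j) p μ) atTop (𝓝 (relaxation p μ (chainEnergy p μ) u)) := by
  set r := relaxation p μ (chainEnergy p μ) u with hr
  set a : ℕ → ℝ := fun n => 1 / ((n : ℝ) + 1) with ha
  have ha0 : ∀ n, 0 < a n := fun n => Nat.one_div_pos_of_nat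
  have halim : Tendsto a atTop (𝓝 0) := tendsto_one_div_add_atTop_nhds_zero_nat
  have hb : Tendsto (fun n => 5 * ENNReal.ofReal (a n)) atTop (𝓝 0) := by
    have h1 : Tendsto (fun n => ENNReal.ofReal (a n)) atTop (𝓝 0) := by
      simpa using ENNReal.tendsto_ofReal halim
    simpa using ENNReal.Tendsto.const_mul (a := 5) h1 (Or.inr (by simp))
  have step : ∀ n, ∃ (v : X → ℝ) (ε : ℝ) (g : X → ℝ≥0∞), MemLp v p μ ∧
      (∃ K : ℝ≥0, LipschitzWith K v) ∧ 0 < ε ∧ ε ≤ a n ∧ g ∈ LUG ε v ∧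
      eLpNorm (v - ⇑u) p μ ≤ 5 * ENNReal.ofReal (a n) ∧
      eLpNorm g p μ ≤ r + 5 * ENNReal.ofReal (a n) := by
    intro n
    have hpos : 0 < ENNReal.ofReal (a n) := ENNReal.ofReal_pos.2 (ha0 n)
    have h1 : r < r + ENNReal.ofReal (a n) := ENNReal.lt_add_right hu.ne hpos.ne'
    nth_rewrite 1 [hr] at h1
    simp only [relaxation, iInf_lt_iff] at h1
    obtain ⟨w, ⟨hwp, hwu⟩, hw⟩ := h1
    obtain ⟨j, hj1, hj2⟩ := ((frequently_lt_of_liminf_lt (by isBoundedDefault) hw).and_eventually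
      (hwu.eventually (eventually_le_nhds hpos))).exists
    simp only [chainEnergy, chainEnergyAt, iInf_lt_iff] at hj1
    obtain ⟨ε, hε, g, hg, hgr⟩ := hj1
    obtain ⟨v, g', ρ, hv, hvL, hρ, hg', hvw, hgg⟩ :=
      exists_lipschitz_approx hμ hp₁ hp (hwp j) hε hg hgr.ne_top (ha0 n)
    refine ⟨v, min ρ (a n), g', hv, hvL, lt_min hρ (ha0 n), min_le_right _ _,
      LUG_subset (min_le_left _ _) v hg', ?_, ?_⟩
    · have e : v - ⇑u = (v - w j) + (w j - ⇑u) := by abel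
      rw [e]
      refine (eLpNorm_add_le (hv.1.sub (hwp j).1)
        ((hwp j).1.sub (Lp.aestronglyMeasurable u)) hp₁).trans ((add_le_add hvw hj2).trans_eq ?_)
      ring
    · refine hgg.trans ((add_le_add hgr.le le_rfl).trans_eq ?_)
      ring
  choose v ε g hv hvL hε hεa hg hvu hgr using step
  have hvu' : Tendsto (fun j => eLpNorm (v j - ⇑u) p μ) atTop (𝓝 0) :=
    tendsto_of_tendsto_of_tendsto_of_le_of_le tendsto_const_nhds hb (fun _ => zero_le) hvu
  refine ⟨v, ε, g, fun j => ⟨hv j, hvL j, hε j, hg j⟩,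
    tendsto_of_tendsto_of_tendsto_of_le_of_le tendsto_const_nhds halim (fun j => (hε j).le) hεa,
    hvu', tendsto_of_le_liminf_of_limsup_le ?_ ?_⟩
  -- The new sequence is itself a competitor for the relaxation, so its gradient norms cannot drop
  -- below `r` in the limit.
  · refine (iInf₂_le (f := fun (v : ℕ → X → ℝ) _ => liminf (fun j => chainEnergy p μ (v j)) atTop)
      v ⟨hv, hvu'⟩).trans ?_
    exact liminf_le_liminf (Eventually.of_forall fun j => chainEnergy_le_eLpNorm (hε j) (hg j).1)
  · have h1 : Tendsto (fun n => r + 5 * ENNReal.ofReal (a n)) atTop (𝓝 r) := by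
      simpa using hb.const_add r
    rw [← h1.limsup_eq]
    exact limsup_le_limsup (Eventually.of_forall hgr)

theorem relaxation_lipChainEnergy (hμ : ∀ s : Set X, Bornology.IsBounded s → μ s < ∞)
    (hp₁ : 1 ≤ p) (hp : p ≠ ∞) (u : Lp ℝ p μ) :
    relaxation p μ (lipChainEnergy p μ) u = relaxation p μ (chainEnergy p μ) u := by
  refine le_antisymm ?_ (relaxation_mono chainEnergy_le_lipChainEnergy u)
  rcases eq_or_ne (relaxation p μ (chainEnergy p μ) u) ∞ with h | h
  · rw [h]; exact le_top
  obtain ⟨v, ε, g, hv, -, hvu, hg⟩ := exists_lipschitz_recovery_seq hμ hp₁ hp u h.lt_top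
  rw [← hg.liminf_eq]
  refine (iInf₂_le (f := fun (v : ℕ → X → ℝ) _ => liminf (fun j => lipChainEnergy p μ (v j)) atTop)
    v ⟨fun j => (hv j).1, hvu⟩).trans ?_
  exact liminf_le_liminf (Eventually.of_forall fun j =>
    lipChainEnergy_le_eLpNorm (hv j).2.1 (hv j).2.2.1 (hv j).2.2.2)

end Relaxation

end ChainSobolev

end

theorem mainTheorem4 {X : Type*} [MetricSpace X] [CompleteSpace X]
    [TopologicalSpace.SeparableSpace X] [MeasurableSpace X] [BorelSpace X]
    (μ : Measure X) (hμ : ∀ s : Set X, Bornology.IsBounded s → μ s < ∞)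
    (p : ℝ≥0∞) (hp₁ : 1 ≤ p) (hp : p ≠ ∞) :
    ChainSobolev.sobolevSpace p μ (ChainSobolev.lipChainEnergy p μ) =
        ChainSobolev.sobolevSpace p μ (ChainSobolev.chainEnergy p μ) ∧
      (∀ u : Lp ℝ p μ,
        ChainSobolev.sobolevNorm p μ (ChainSobolev.lipChainEnergy p μ) u =
          ChainSobolev.sobolevNorm p μ (ChainSobolev.chainEnergy p μ) u) ∧
      (∀ u ∈ ChainSobolev.sobolevSpace p μ (ChainSobolev.chainEnergy p μ),
        ∃ (v : ℕ → X → ℝ) (ε : ℕ → ℝ) (g : ℕ → X → ℝ≥0∞),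
          (∀ j, MemLp (v j) p μ ∧ (∃ K : ℝ≥0, LipschitzWith K (v j)) ∧
            0 < ε j ∧ g j ∈ ChainSobolev.LUG (ε j) (v j)) ∧
          Tendsto ε atTop (𝓝 0) ∧
          Tendsto (fun j => eLpNorm (v j - ⇑u) p μ) atTop (𝓝 0) ∧
          Tendsto (fun j => eLpNorm (g j) p μ) atTop
            (𝓝 (ChainSobolev.relaxation p μ (ChainSobolev.chainEnergy p μ) u))) := by
  have h := ChainSobolev.relaxation_lipChainEnergy hμ hp₁ hp
  refine ⟨?_, fun u => ?_, fun u hu => ChainSobolev.exists_lipschitz_recovery_seq hμ hp₁ hp u hu⟩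
  · ext u
    simp only [ChainSobolev.sobolevSpace, Set.mem_ofPred_eq, h u]
  · simp only [ChainSobolev.sobolevNorm, h u]
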